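/- **Setting.** Let $V=(V,\otimes,k)$ be a commutative quantale (a complete lattice with a commutative monoid structure such that $\otimes$ preserves arbitrary suprema in each variable) with $\bot<k$, and write $\hom(u,-)$ for the right adjoint of $u\otimes-$. A *(strict) topological theory* $\mathcal T=(\mathbb T,V,\xi)$ consists of $V$, a monad $\mathbb T=(T,e,m)$ on $\mathbf{Set}$ such that $T$ sends pullbacks to weak pullbacks and every naturality square of $m$ is a weak pullback, and a map $\xi:TV\to V$ such that $(V,\xi)$ is an Eilenberg–Moore algebra of $\mathbb T$, the maps $\otimes:V\times V\to V$ and $k:1\to V$ are algebra homomorphisms, and the maps $\xi_X:V^X\to V^{TX}$, $\varphi\mapsto\xi\cdot T\varphi$, are monotone and natural in $X$ with respect to the covariant $V$-powerset functor $P_V f(\varphi)(y)=\bigvee_{f(x)=y}\varphi(x)$. For a $V$-relation $r:X\times Y\to V$ put $T_\xi r(\mathfrak x,\mathfrak y)=\bigvee\{\xi(Tr(\mathfrak w))\mid \mathfrak w\in T(X\times Y),\ T\pi_1(\mathfrak w)=\mathfrak x,\ T\pi_2(\mathfrak w)=\mathfrak y\}$. A *$\mathcal T$-category* is a set $X$ with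 a map $a:TX\times X\to V$ such that $k\le a(e_X(x),x)$ and $T_\xi a(\mathfrak X,\mathfrak x)\otimes a(\mathfrak x,x)\le a(m_X(\mathfrak X),x)$. A *$\mathcal T$-functor* $f:(X,a)\to(Y,b)$ is a map with $a(\mathfrak x,x)\le b(Tf(\mathfrak x),f(x))$; put $f_*(\mathfrak x,y)=b(Tf(\mathfrak x),y)$ and $f^*(\mathfrak y,x)=b(\mathfrak y,f(x))$, and order $\mathcal T$-functors $X\to Y$ by $f\le g\iff f^*\le g^*$ pointwise. A $\mathcal T$-functor $f:X\to Y$ is *left adjoint* if there is a $\mathcal T$-functor $g:Y\to X$ with $1_X\le g f$ and $f g\le 1_Y$. A $\mathcal T$-category $X$ is *L-separated* if $f\le g$ and $g\le f$ imply $f=g$ for all $\mathcal T$-functors $f,g$ with codomain $X$. For $\alpha:TX\times Y\to V$ and $\beta:TY\times Z\to V$ put $(\beta\circ\alpha)(\mathfrak x,z)=\bigvee_{m_X(\mathfrak X)=\mathfrak x,\ \mathfrak y\in TY}T_\xi\alpha(\mathfrak X,\mathfrak y)\otimes\beta(\mathfrak y,z)$. For fixed $\alpha$ and $Z$, the monotone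 map $\beta\mapsto\beta\circ\alpha$ has a right adjoint, which sends $\gamma:TX\times Z\to V$ to the largest $\beta$ with $\beta\circ\alpha\le\gamma$, the *extension* of $\gamma$ along $\alpha$. A *$\mathcal T$-module* from $(X,a)$ to $(Y,b)$ is a map $\varphi:TX\times Y\to V$ with $\varphi\circ a\le\varphi$ and $b\circ\varphi\le\varphi$. A $\mathcal T$-category $X$ is *cocomplete* if for all $\mathcal T$-categories $Y,Z$, every $\mathcal T$-functor $h:Y\to X$ and every $\mathcal T$-module $\psi$ from $Y$ to $Z$ there is a $\mathcal T$-functor $g:Z\to X$ such that $g_*$ is the extension of $h_*$ along $\psi$. **Theorem.** Let $\mathcal T$ be a topological theory, and let $\mathbf{Cocompl}_{\mathrm{sep}}(\mathcal T)$ be the category of L-separated cocomplete $\mathcal T$-categories and left adjoint $\mathcal T$-functors. The forgetful functor $G:\mathbf{Cocompl}_{\mathrm{sep}}(\mathcal T)\to\mathbf{Set}$ is monadic (it has a left adjoint, and the comparison functor to the Eilenberg–Moore category of the induced monad is an equivalence). Consequently $\mathbf{Cocompl}_{\mathrm{sep}}(\mathcal T)$ is cocomplete, i.e. has all small colimits.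 -/

import Mathlib

open CategoryTheory CategoryTheory.Limits
open scoped Quantale

universe u

namespace TopTheory

/-! ### Weak pullbacks and monads on `Set` -/

/-- A commutative square `fst ≫ f = snd ≫ g` is a weak pullback if every other cone over the
cospan `(f, g)` factors through it, not necessarily uniquely. -/
structure IsWeakPullback {C : Type*} [Category C] {P X Y Z : C}
    (fst : P ⟶ X) (snd : P ⟶ Y) (f : X ⟶ Z) (g : Y ⟶ Z) : Prop extends
    CommSq fst snd f g where
  isWeakLimit : Nonempty (IsWeakLimit (PullbackCone.mk fst snd w))

/-- The map `T f : T X → T Y` of a function `f : X → Y`, for a monad `T` on `Set`. -/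
def mapT (T : Monad (Type u)) {X Y : Type u} (f : X → Y) : T.obj X → T.obj Y :=
  fun x => T.map (↾f) x

/-- The unit `e_X : X → T X`, as a function. -/
def unitT (T : Monad (Type u)) (X : Type u) : X → T.obj X :=
  fun x => T.η.app X x

/-- The multiplication `m_X : T T X → T X`, as a function. -/
def multT (T : Monad (Type u)) (X : Type u) : T.obj (T.obj X) → T.obj X :=
  fun x => T.μ.app X x

/-! ### `V`-relations -/

/-- A `V`-relation from `X` to `Y`, with the pointwise order. -/
abbrev VRel (V X Y : Type u) : Type u := X → Y → V

section VRelations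

variable {V : Type u} [CommMonoid V] [CompleteLattice V] [IsQuantale V] {X Y Z : Type u}

/-- The composite `s · r` of `V`-relations (matrix multiplication). -/
def VRel.comp (s : VRel V Y Z) (r : VRel V X Y) : VRel V X Z :=
  fun x z => ⨆ y, r x y * s y z

/-- The converse `r°`. -/
def VRel.conv (r : VRel V X Y) : VRel V Y X :=
  fun y x => r x y

open Classical in
/-- A function regarded as a `V`-relation (its graph). -/
noncomputable def VRel.graph (V : Type u) [CommMonoid V] [CompleteLattice V] {X Y : Type u}
    (f : X → Y) : VRel V X Y :=
  fun x y => if f x = y then 1 else ⊥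

/-- The extension of `r` along `t`: the largest `s` with `s · t ≤ r`. -/
def VRel.extend (r : VRel V X Y) (t : VRel V X Z) : VRel V Z Y :=
  fun z y => ⨅ x, t x z ⇨ᵣ r x y

theorem VRel.le_extend_iff (r : VRel V X Y) (t : VRel V X Z) (s : VRel V Z Y) :
    s ≤ r.extend t ↔ s.comp t ≤ r := by
  simp only [Pi.le_def, VRel.extend, VRel.comp, le_iInf_iff, iSup_le_iff,
    Quantale.rightMulResiduation_le_iff_mul_le]
  exact ⟨fun h x y z => h z y x, fun h z y x => h x y z⟩

end VRelations

/-! ### Topological theories -/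

/-- A (strict) topological theory `(T, V, ξ)` over the commutative quantale `V`, whose tensor is
written `*` and whose neutral element `k` is written `1`. -/
structure Theory (V : Type u) [CommMonoid V] [CompleteLattice V] [IsQuantale V] where
  /-- the monad on `Set` -/
  T : Monad (Type u)
  /-- `T` sends pullbacks to weak pullbacks -/
  map_isPullback : ∀ {P X Y Z : Type u} {fst : P ⟶ X} {snd : P ⟶ Y} {f : X ⟶ Z} {g : Y ⟶ Z},
    IsPullback fst snd f g → IsWeakPullback (T.map fst) (T.map snd) (T.map f) (T.map g)
  /-- the naturality squares of the multiplication are weak pullbacks -/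
  mult_isWeakPullback : ∀ {X Y : Type u} (f : X ⟶ Y),
    IsWeakPullback (T.map (T.map f)) (T.μ.app X) (T.μ.app Y) (T.map f)
  /-- the structure map -/
  ξ : T.obj V → V
  /-- `ξ` is an Eilenberg--Moore algebra structure: unit law -/
  ξ_unit : ∀ v : V, ξ (unitT T V v) = v
  /-- `ξ` is an Eilenberg--Moore algebra structure: multiplication law -/
  ξ_mult : ∀ w : T.obj (T.obj V), ξ (mapT T ξ w) = ξ (multT T V w)
  /-- the neutral element `1 → V` is an algebra homomorphism -/
  ξ_one : ∀ a : T.obj PUnit.{u + 1}, ξ (mapT T (fun _ => (1 : V)) a) = 1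
  /-- the tensor `V × V → V` is an algebra homomorphism -/
  ξ_mul : ∀ w : T.obj (V × V),
    ξ (mapT T (fun p : V × V => p.1 * p.2) w) = ξ (mapT T Prod.fst w) * ξ (mapT T Prod.snd w)
  /-- each `ξ_X = ξ · T(-) : V^X → V^(T X)` is monotone -/
  ξ_mono : ∀ {X : Type u} {φ ψ : X → V}, φ ≤ ψ → ∀ x : T.obj X,
    ξ (mapT T φ x) ≤ ξ (mapT T ψ x)
  /-- `ξ_X` is natural in `X` for the covariant `V`-powerset functor -/
  ξ_natural : ∀ {X Y : Type u} (f : X → Y) (φ : X → V) (y : T.obj Y),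
    ξ (mapT T (fun y' => ⨆ (x : X) (_ : f x = y'), φ x) y) =
      ⨆ (x : T.obj X) (_ : mapT T f x = y), ξ (mapT T φ x)

variable {V : Type u} [CommMonoid V] [CompleteLattice V] [IsQuantale V] (𝕋 : Theory V)

/-- The extension `T_ξ` of `T` to `V`-relations. -/
def Theory.lift {X Y : Type u} (r : VRel V X Y) : VRel V (𝕋.T.obj X) (𝕋.T.obj Y) :=
  fun x y => ⨆ (w : 𝕋.T.obj (X × Y)) (_ : mapT 𝕋.T Prod.fst w = x) (_ : mapT 𝕋.T Prod.snd w = y),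
    𝕋.ξ (mapT 𝕋.T (fun p : X × Y => r p.1 p.2) w)

/-- A `𝕋`-relation from `X` to `Y` is a `V`-relation from `T X` to `Y`. -/
abbrev TRel (X Y : Type u) : Type u := VRel V (𝕋.T.obj X) Y

variable {𝕋}

/-- The `V`-relation `T_ξ α · m_X° : T X → T Y` of a `𝕋`-relation `α` from `X` to `Y`. -/
noncomputable def TRel.kleisliLift {X Y : Type u} (α : TRel 𝕋 X Y) :
    VRel V (𝕋.T.obj X) (𝕋.T.obj Y) :=
  (𝕋.lift α).comp (VRel.graph V (multT 𝕋.T X)).conv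

/-- The Kleisli convolution `β ∘ α = β · T_ξ α · m_X°`. -/
noncomputable def TRel.kleisli {X Y Z : Type u} (β : TRel 𝕋 Y Z) (α : TRel 𝕋 X Y) : TRel 𝕋 X Z :=
  VRel.comp β α.kleisliLift

/-- The extension of `γ` along `α` with respect to Kleisli convolution, that is, the extension
of the `V`-relation `γ` along `T_ξ α · m_X°`. -/
noncomputable def TRel.extend {X Y Z : Type u} (γ : TRel 𝕋 X Z) (α : TRel 𝕋 X Y) : TRel 𝕋 Y Z :=
  VRel.extend γ α.kleisliLift

theorem TRel.le_extend_iff {X Y Z : Type u} (γ : TRel 𝕋 X Z) (α : TRel 𝕋 X Y) (β : TRel 𝕋 Y Z) :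
    β ≤ γ.extend α ↔ β.kleisli α ≤ γ :=
  VRel.le_extend_iff γ α.kleisliLift β

/-! ### `𝕋`-categories and `𝕋`-functors -/

variable (𝕋)

/-- A `𝕋`-category `(X, a)`. -/
structure TCat where
  /-- the underlying set -/
  carrier : Type u
  /-- the structure `a : T X → X → V` -/
  str : TRel 𝕋 carrier carrier
  one_le_str : ∀ x : carrier, 1 ≤ str (unitT 𝕋.T carrier x) x
  str_trans : ∀ (W : 𝕋.T.obj (𝕋.T.obj carrier)) (w : 𝕋.T.obj carrier) (x : carrier),
    𝕋.lift str W w * str w x ≤ str (multT 𝕋.T carrier W) x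

variable {𝕋}

instance : CoeSort (TCat 𝕋) (Type u) := ⟨TCat.carrier⟩

/-- A `𝕋`-functor `(X, a) → (Y, b)`. -/
@[ext]
structure TFunctor (X Y : TCat 𝕋) where
  /-- the underlying function -/
  toFun : X → Y
  str_le : ∀ (w : 𝕋.T.obj X) (x : X), X.str w x ≤ Y.str (mapT 𝕋.T toFun w) (toFun x)

theorem mapT_id (T : Monad (Type u)) {X : Type u} (w : T.obj X) :
    mapT T (fun x : X => x) w = w := by
  change (ConcreteCategory.hom (T.map (𝟙 X))) w = w
  simp

theorem mapT_comp (T : Monad (Type u)) {X Y Z : Type u} (g : Y → Z) (f : X → Y) (w : T.obj X) :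
    mapT T (fun x => g (f x)) w = mapT T g (mapT T f w) := by
  change (ConcreteCategory.hom (T.map (↾f ≫ ↾g))) w = _
  simp [mapT]

theorem mapT_unitT (T : Monad (Type u)) {X Y : Type u} (f : X → Y) (x : X) :
    mapT T f (unitT T X x) = unitT T Y (f x) :=
  (ConcreteCategory.congr_hom (T.η.naturality (↾f)) x).symm

theorem multT_unitT (T : Monad (Type u)) {X : Type u} (w : T.obj X) :
    multT T X (unitT T (T.obj X) w) = w :=
  ConcreteCategory.congr_hom (T.left_unit X) w

/-- The identity `𝕋`-functor. -/
def TFunctor.id (X : TCat 𝕋) : TFunctor X X where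
  toFun x := x
  str_le w x := by rw [mapT_id]

/-- The composite `g · f` of `𝕋`-functors. -/
def TFunctor.comp {X Y Z : TCat 𝕋} (g : TFunctor Y Z) (f : TFunctor X Y) : TFunctor X Z where
  toFun x := g.toFun (f.toFun x)
  str_le w x := by
    rw [mapT_comp]
    exact (f.str_le w x).trans (g.str_le _ _)

/-- The category of `𝕋`-categories and `𝕋`-functors. -/
instance : Category (TCat 𝕋) where
  Hom := TFunctor
  id := TFunctor.id
  comp f g := g.comp f

/-- The `𝕋`-relation `f_* = b · T f`. -/
def TFunctor.lowerStar {X Y : TCat 𝕋} (f : TFunctor X Y) : TRel 𝕋 X Y :=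
  fun w y => Y.str (mapT 𝕋.T f.toFun w) y

/-- The `𝕋`-relation `f^* = f° · b`. -/
def TFunctor.upperStar {X Y : TCat 𝕋} (f : TFunctor X Y) : TRel 𝕋 Y X :=
  fun w x => Y.str w (f.toFun x)

/-- `f ≤ g` if and only if `f^* ≤ g^*`. -/
instance (X Y : TCat 𝕋) : Preorder (TFunctor X Y) := Preorder.lift TFunctor.upperStar

/-- `X` is L-separated if equivalent `𝕋`-functors with codomain `X` are equal. -/
def TCat.IsLSeparated (X : TCat 𝕋) : Prop :=
  ∀ (Y : TCat 𝕋) (f g : TFunctor Y X), f ≤ g → g ≤ f → f = g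

/-- `f` is left adjoint: there is a `𝕋`-functor `g` with `1 ≤ g · f` and `f · g ≤ 1`. -/
def TFunctor.IsLeftAdjoint {X Y : TCat 𝕋} (f : TFunctor X Y) : Prop :=
  ∃ g : TFunctor Y X, TFunctor.id X ≤ g.comp f ∧ f.comp g ≤ TFunctor.id Y

/-! ### Modules, weighted colimits, cocompleteness -/

/-- `φ` is a `𝕋`-module from `(X, a)` to `(Y, b)`: `φ ∘ a ≤ φ` and `b ∘ φ ≤ φ`. -/
def IsModule (X Y : TCat 𝕋) (φ : TRel 𝕋 X Y) : Prop :=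
  TRel.kleisli φ X.str ≤ φ ∧ TRel.kleisli Y.str φ ≤ φ

/-- `g` is a `ψ`-weighted colimit of `h`: it represents the extension of `h_*` along `ψ`. -/
def IsWeightedColimit {X Y Z : TCat 𝕋} (ψ : TRel 𝕋 Y Z) (h : TFunctor Y X)
    (g : TFunctor Z X) : Prop :=
  g.lowerStar = TRel.extend h.lowerStar ψ

/-- `X` is cocomplete: every weighted diagram in `X` has a colimit. -/
def TCat.IsCocomplete (X : TCat 𝕋) : Prop :=
  ∀ (Y Z : TCat 𝕋) (h : TFunctor Y X) (ψ : TRel 𝕋 Y Z), IsModule Y Z ψ →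
    ∃ g : TFunctor Z X, IsWeightedColimit ψ h g

/-! ### The category of L-separated cocomplete `𝕋`-categories -/

/-- The structure of a `𝕋`-category is a `V`-relation compatible with its underlying order. -/
theorem TCat.str_mono (X : TCat 𝕋) {x y : X} (h : 1 ≤ X.str (unitT 𝕋.T X x) y)
    (w : 𝕋.T.obj X) : X.str w x ≤ X.str w y := by
  have h1 : X.str w x ≤ 𝕋.lift X.str (unitT 𝕋.T _ w) (unitT 𝕋.T _ x) := by
    refine le_iSup_of_le (unitT 𝕋.T _ (w, x)) (le_iSup_of_le (mapT_unitT _ _ _)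
      (le_iSup_of_le (mapT_unitT _ _ _) ?_))
    rw [mapT_unitT, 𝕋.ξ_unit]
  have h2 := X.str_trans (unitT 𝕋.T _ w) (unitT 𝕋.T _ x) y
  rw [multT_unitT] at h2
  calc X.str w x = X.str w x * 1 := (mul_one _).symm
    _ ≤ _ := mul_le_mul' h1 h
    _ ≤ _ := h2

theorem TFunctor.le_iff {X Y : TCat 𝕋} (f g : TFunctor X Y) :
    f ≤ g ↔ ∀ x, 1 ≤ Y.str (unitT 𝕋.T Y (f.toFun x)) (g.toFun x) :=
  ⟨fun h x => (Y.one_le_str (f.toFun x)).trans (h _ x), fun h w x => Y.str_mono (h x) w⟩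

theorem TFunctor.comp_mono {X Y Z : TCat 𝕋} {g g' : TFunctor Y Z} {f f' : TFunctor X Y}
    (hg : g ≤ g') (hf : f ≤ f') : g.comp f ≤ g'.comp f' := by
  refine le_trans (b := g.comp f') ?_ (fun w x => hg w (f'.toFun x))
  rw [TFunctor.le_iff] at hf ⊢
  intro x
  have h := g.str_le (unitT 𝕋.T Y (f.toFun x)) (f'.toFun x)
  rw [mapT_unitT] at h
  exact (hf x).trans h

theorem TFunctor.isLeftAdjoint_id (X : TCat 𝕋) : (TFunctor.id X).IsLeftAdjoint :=
  ⟨TFunctor.id X, le_rfl, le_rfl⟩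

theorem TFunctor.IsLeftAdjoint.comp {X Y Z : TCat 𝕋} {g : TFunctor Y Z} {f : TFunctor X Y}
    (hg : g.IsLeftAdjoint) (hf : f.IsLeftAdjoint) : (g.comp f).IsLeftAdjoint := by
  obtain ⟨f', hf1, hf2⟩ := hf
  obtain ⟨g', hg1, hg2⟩ := hg
  exact ⟨f'.comp g',
    hf1.trans (TFunctor.comp_mono le_rfl (TFunctor.comp_mono hg1 (le_refl f))),
    (TFunctor.comp_mono le_rfl (TFunctor.comp_mono hf2 (le_refl g'))).trans hg2⟩

variable (𝕋)

/-- Objects: the L-separated cocomplete `𝕋`-categories. -/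
structure CocomplSep where
  /-- the underlying `𝕋`-category -/
  toTCat : TCat 𝕋
  isLSeparated : toTCat.IsLSeparated
  isCocomplete : toTCat.IsCocomplete

variable {𝕋}

/-- Morphisms: the left adjoint `𝕋`-functors. -/
@[ext]
structure CocomplSep.Hom (X Y : CocomplSep 𝕋) where
  /-- the underlying `𝕋`-functor -/
  toTFunctor : TFunctor X.toTCat Y.toTCat
  isLeftAdjoint : toTFunctor.IsLeftAdjoint

/-- The category of L-separated cocomplete `𝕋`-categories and left adjoint `𝕋`-functors. -/
instance : Category (CocomplSep 𝕋) where
  Hom := CocomplSep.Hom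
  id X := ⟨TFunctor.id X.toTCat, TFunctor.isLeftAdjoint_id _⟩
  comp f g := ⟨g.toTFunctor.comp f.toTFunctor, g.isLeftAdjoint.comp f.isLeftAdjoint⟩

variable (𝕋)

/-- The forgetful functor to `Set`. -/
def CocomplSep.forget : CocomplSep 𝕋 ⥤ Type u where
  obj X := X.toTCat.carrier
  map f := ↾f.toTFunctor.toFun

end TopTheory

namespace TopTheory

/-! ### Elementwise forms of the conditions on the monad -/

/-! The free L-separated cocomplete `𝕋`-category on a set `S` is the category `P S` of presheaves on
the discrete `S`. For `h : S → X` the nerve `x ↦ X(T h -, x)` is a `𝕋`-functor `X → P S`; if `X` is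
cocomplete it has a left adjoint, the colimit of `h` weighted by evaluation (`exists_adj_nerve`). By
the Yoneda lemma this left adjoint extends `h`, and the right adjoint of any extension must be the
nerve, so the extension is unique (`nerve_yoneda`, `eq_of_yoneda`). This makes the forgetful functor
a right adjoint.

Beck's theorem then reduces to closure operators. If `f, g : X ⟶ Y` are split in sets by `q`, `s`,
`t`, with right adjoints `f'`, `g'`, then `d = g f' f g'` is a closure operator on `Y` sending each
point to the largest element of its `q`-class (`exists_isClosure`). The fixed points of `d` are
again L-separated and cocomplete, and they form the coequalizer both here and in sets.

For colimits, monadicity over sets gives all limits, and the adjoint functor theorem applies to the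
diagonal functors: every cocone factors through the fixed points of a closure operator on one free
object, and such cocones form a set.

All of this rests on associativity of Kleisli convolution: `T_ξ` preserves composition of relations
because `T` weakly preserves pullbacks, and the weak pullback squares of `m` make `α ↦ T_ξ α · m°`
preserve Kleisli convolution (`kleisliLift_kleisli`). -/

theorem IsWeakPullback.exists_of_eq {P X Y Z : Type u} {fst : P ⟶ X} {snd : P ⟶ Y} {f : X ⟶ Z}
    {g : Y ⟶ Z} (h : IsWeakPullback fst snd f g) (x : X) (y : Y) (hxy : f x = g y) :
    ∃ p : P, fst p = x ∧ snd p = y := by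
  obtain ⟨ht⟩ := h.isWeakLimit
  have hw : (↾(fun _ : PUnit.{u + 1} => x)) ≫ f = (↾(fun _ : PUnit.{u + 1} => y)) ≫ g := by
    ext; exact hxy
  refine ⟨PullbackCone.IsWeakLimit.lift ht _ _ hw PUnit.unit, ?_, ?_⟩
  · exact ConcreteCategory.congr_hom (PullbackCone.IsWeakLimit.lift_fst ht _ _ hw) PUnit.unit
  · exact ConcreteCategory.congr_hom (PullbackCone.IsWeakLimit.lift_snd ht _ _ hw) PUnit.unit

theorem multT_mapT_unitT (T : Monad (Type u)) {X : Type u} (w : T.obj X) :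
    multT T X (mapT T (unitT T X) w) = w :=
  ConcreteCategory.congr_hom (T.right_unit X) w

theorem mapT_multT (T : Monad (Type u)) {X Y : Type u} (f : X → Y) (w : T.obj (T.obj X)) :
    mapT T f (multT T X w) = multT T Y (mapT T (mapT T f) w) :=
  (ConcreteCategory.congr_hom (T.μ.naturality (↾f)) w).symm

theorem multT_multT (T : Monad (Type u)) {X : Type u} (w : T.obj (T.obj (T.obj X))) :
    multT T X (mapT T (multT T X) w) = multT T X (multT T (T.obj X) w) :=
  ConcreteCategory.congr_hom (T.assoc X) w

variable {V : Type u} [CommMonoid V] [CompleteLattice V] [IsQuantale V] (𝕋 : Theory V)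

theorem Theory.exists_mapT {P X Y Z : Type u} (fst : P → X) (snd : P → Y) (f : X → Z) (g : Y → Z)
    (hc : ∀ p, f (fst p) = g (snd p))
    (hu : ∀ x y, f x = g y → ∃! p, fst p = x ∧ snd p = y)
    (x : 𝕋.T.obj X) (y : 𝕋.T.obj Y) (h : mapT 𝕋.T f x = mapT 𝕋.T g y) :
    ∃ p, mapT 𝕋.T fst p = x ∧ mapT 𝕋.T snd p = y := by
  have hp : IsPullback (↾fst) (↾snd) (↾f) (↾g) := by
    rw [Types.isPullback_iff]
    refine ⟨by ext p; exact hc p, fun p q h => ?_, fun x y hxy => (hu x y hxy).exists⟩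
    exact (hu (fst p) (snd p) (hc p)).unique ⟨rfl, rfl⟩ ⟨h.1.symm, h.2.symm⟩
  exact (𝕋.map_isPullback hp).exists_of_eq x y h

theorem Theory.exists_multT {X Y : Type u} (f : X → Y) (w : 𝕋.T.obj X)
    (y : 𝕋.T.obj (𝕋.T.obj Y)) (h : multT 𝕋.T Y y = mapT 𝕋.T f w) :
    ∃ x, mapT 𝕋.T (mapT 𝕋.T f) x = y ∧ multT 𝕋.T X x = w :=
  (𝕋.mult_isWeakPullback (↾f)).exists_of_eq y w h

/-! ### The extension to `V`-relations -/

variable {𝕋}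

section Lift

variable {X Y Z : Type u}

theorem Theory.ξ_const_one (w : 𝕋.T.obj X) : 𝕋.ξ (mapT 𝕋.T (fun _ => (1 : V)) w) = 1 := by
  rw [mapT_comp 𝕋.T (fun _ : PUnit.{u + 1} => (1 : V)) (fun _ : X => PUnit.unit), 𝕋.ξ_one]

theorem Theory.ξ_mapT_mul (φ ψ : X → V) (w : 𝕋.T.obj X) :
    𝕋.ξ (mapT 𝕋.T (fun x => φ x * ψ x) w) = 𝕋.ξ (mapT 𝕋.T φ w) * 𝕋.ξ (mapT 𝕋.T ψ w) := by
  rw [mapT_comp 𝕋.T (fun p : V × V => p.1 * p.2) (fun x => (φ x, ψ x)), 𝕋.ξ_mul,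
    ← mapT_comp, ← mapT_comp]

theorem Theory.ξ_mapT_ξ (φ : X → V) (w : 𝕋.T.obj (𝕋.T.obj X)) :
    𝕋.ξ (mapT 𝕋.T (fun x => 𝕋.ξ (mapT 𝕋.T φ x)) w) = 𝕋.ξ (mapT 𝕋.T φ (multT 𝕋.T X w)) := by
  rw [mapT_comp 𝕋.T 𝕋.ξ (fun x => mapT 𝕋.T φ x), 𝕋.ξ_mult, mapT_multT]

theorem Theory.le_lift (r : VRel V X Y) (w : 𝕋.T.obj (X × Y)) :
    𝕋.ξ (mapT 𝕋.T (fun p : X × Y => r p.1 p.2) w) ≤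
      𝕋.lift r (mapT 𝕋.T Prod.fst w) (mapT 𝕋.T Prod.snd w) :=
  le_iSup_of_le w (le_iSup_of_le rfl (le_iSup_of_le rfl le_rfl))

theorem Theory.le_lift_map (r : VRel V X Y) (f : Z → X) (g : Z → Y) (w : 𝕋.T.obj Z) :
    𝕋.ξ (mapT 𝕋.T (fun z => r (f z) (g z)) w) ≤
      𝕋.lift r (mapT 𝕋.T f w) (mapT 𝕋.T g w) := by
  have h := Theory.le_lift r (mapT 𝕋.T (fun z => (f z, g z)) w)
  rwa [← mapT_comp, ← mapT_comp, ← mapT_comp] at h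

theorem Theory.lift_le_iff (r : VRel V X Y) (x : 𝕋.T.obj X) (y : 𝕋.T.obj Y) (v : V) :
    𝕋.lift r x y ≤ v ↔ ∀ w : 𝕋.T.obj (X × Y), mapT 𝕋.T Prod.fst w = x → mapT 𝕋.T Prod.snd w = y →
      𝕋.ξ (mapT 𝕋.T (fun p : X × Y => r p.1 p.2) w) ≤ v := by
  simp only [Theory.lift, iSup_le_iff]

theorem Theory.lift_mono {r s : VRel V X Y} (h : r ≤ s) : 𝕋.lift r ≤ 𝕋.lift s := by
  refine fun x y => (Theory.lift_le_iff r x y _).2 ?_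
  rintro w rfl rfl
  exact (𝕋.ξ_mono (fun p : X × Y => h p.1 p.2) w).trans (Theory.le_lift s w)

theorem Theory.lift_unit (r : VRel V X Y) (x : X) (y : Y) :
    r x y ≤ 𝕋.lift r (unitT 𝕋.T X x) (unitT 𝕋.T Y y) := by
  have h := Theory.le_lift r (unitT 𝕋.T (X × Y) (x, y))
  rwa [mapT_unitT, mapT_unitT, mapT_unitT, 𝕋.ξ_unit] at h

/-- The extension is compatible with substitution along a function in the first variable. -/
theorem Theory.lift_comap_fst_le (r : VRel V X Y) (f : Z → X) (z : 𝕋.T.obj Z) (y : 𝕋.T.obj Y) :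
    𝕋.lift (fun z y => r (f z) y) z y ≤ 𝕋.lift r (mapT 𝕋.T f z) y := by
  rw [Theory.lift_le_iff]
  rintro w rfl rfl
  have h := Theory.le_lift_map r (fun p : Z × Y => f p.1) Prod.snd w
  rwa [mapT_comp] at h

/-- One inequality needs witnesses in `T (X × Y)` to lift to `T (X × Z)`; they do because `X × Z` is
the pullback of `X × Y` and `Z` over `Y`. -/
theorem Theory.lift_comap_snd (r : VRel V X Y) (f : Z → Y) (x : 𝕋.T.obj X) (z : 𝕋.T.obj Z) :
    𝕋.lift r x (mapT 𝕋.T f z) = 𝕋.lift (fun x z => r x (f z)) x z := by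
  apply le_antisymm
  · rw [Theory.lift_le_iff]
    rintro w rfl hw
    obtain ⟨p, rfl, rfl⟩ := 𝕋.exists_mapT (fun p : X × Z => (p.1, f p.2)) Prod.snd Prod.snd f
      (fun _ => rfl) (fun ⟨a, b⟩ z h => ⟨(a, z), ⟨Prod.ext rfl h.symm, rfl⟩, by
        rintro ⟨a', z'⟩ ⟨h1, h2⟩
        exact Prod.ext (Prod.ext_iff.1 h1).1 h2⟩) w z hw
    rw [← mapT_comp, ← mapT_comp]
    exact Theory.le_lift (fun x z => r x (f z)) p
  · rw [Theory.lift_le_iff]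
    rintro w rfl rfl
    have h := Theory.le_lift_map r Prod.fst (fun p : X × Z => f p.2) w
    rwa [mapT_comp 𝕋.T f] at h

theorem Theory.lift_comp (s : VRel V Y Z) (r : VRel V X Y) :
    𝕋.lift (s.comp r) = (𝕋.lift s).comp (𝕋.lift r) := by
  ext x z
  apply le_antisymm
  · rw [Theory.lift_le_iff]
    rintro w rfl rfl
    -- The composite is the pushforward of `r ⊗ s` along `X × Y × Z → X × Z`, so naturality of `ξ`
    -- for the `V`-powerset functor applies.
    have hr : (fun p : X × Z => s.comp r p.1 p.2) = fun p => ⨆ (q : X × Y × Z)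
        (_ : (q.1, q.2.2) = p), r q.1 q.2.1 * s q.2.1 q.2.2 := by
      funext p
      apply le_antisymm
      · exact iSup_le fun y => le_iSup_of_le (p.1, y, p.2) (le_iSup_of_le rfl le_rfl)
      · refine iSup_le fun q => iSup_le ?_
        rintro rfl
        exact le_iSup_of_le q.2.1 le_rfl
    rw [hr, 𝕋.ξ_natural (fun q : X × Y × Z => (q.1, q.2.2))]
    refine iSup_le fun v => iSup_le ?_
    rintro rfl
    rw [Theory.ξ_mapT_mul, ← mapT_comp, ← mapT_comp]
    exact le_iSup_of_le (mapT 𝕋.T (fun q => q.2.1) v)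
      (mul_le_mul' (Theory.le_lift_map _ _ _ _) (Theory.le_lift_map _ _ _ _))
  · refine iSup_le fun y => ?_
    rw [← Quantale.rightMulResiduation_le_iff_mul_le, Theory.lift_le_iff]
    rintro v hv rfl
    rw [Quantale.rightMulResiduation_le_iff_mul_le, mul_comm,
      ← Quantale.rightMulResiduation_le_iff_mul_le, Theory.lift_le_iff]
    rintro u rfl hu
    rw [Quantale.rightMulResiduation_le_iff_mul_le, mul_comm]
    -- Two witnesses agreeing over `T Y` glue, since `X × Y × Z` is the pullback of `X × Y` and `Y ×
    -- Z` over `Y`.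
    obtain ⟨p, rfl, rfl⟩ := 𝕋.exists_mapT (fun p : X × Y × Z => (p.1, p.2.1)) Prod.snd Prod.snd
      Prod.fst (fun _ => rfl) (fun ⟨a, b⟩ ⟨b', c⟩ h => ⟨(a, b', c), ⟨Prod.ext rfl h.symm, rfl⟩, by
        rintro ⟨a', b', c'⟩ ⟨h1, h2⟩
        exact Prod.ext (Prod.ext_iff.1 h1).1 h2⟩) u v (hu.trans hv.symm)
    rw [← mapT_comp, ← mapT_comp, ← mapT_comp, ← mapT_comp, ← Theory.ξ_mapT_mul]
    exact (𝕋.ξ_mono (fun q : X × Y × Z => le_iSup (fun y => r q.1 y * s y q.2.2) q.2.1) p).trans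
      (Theory.le_lift_map (s.comp r) (fun q : X × Y × Z => q.1) (fun q => q.2.2) p)

theorem Theory.lift_lift_le (r : VRel V X Y) (x : 𝕋.T.obj (𝕋.T.obj X))
    (y : 𝕋.T.obj (𝕋.T.obj Y)) :
    𝕋.lift (𝕋.lift r) x y ≤ 𝕋.lift r (multT 𝕋.T X x) (multT 𝕋.T Y y) := by
  rw [Theory.lift_le_iff]
  rintro w rfl rfl
  -- `T_ξ r` is the pushforward of `ξ · T r` along `T (X × Y) → T X × T Y`.
  have hr : (fun p : 𝕋.T.obj X × 𝕋.T.obj Y => 𝕋.lift r p.1 p.2) = fun p =>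
      ⨆ (q : 𝕋.T.obj (X × Y)) (_ : (mapT 𝕋.T Prod.fst q, mapT 𝕋.T Prod.snd q) = p),
        𝕋.ξ (mapT 𝕋.T (fun p : X × Y => r p.1 p.2) q) := by
    funext p
    apply le_antisymm
    · rw [Theory.lift_le_iff]
      intro q h1 h2
      exact le_iSup_of_le q (le_iSup_of_le (Prod.ext h1 h2) le_rfl)
    · refine iSup_le fun q => iSup_le ?_
      rintro rfl
      exact Theory.le_lift r q
  rw [hr, 𝕋.ξ_natural (fun q => (mapT 𝕋.T Prod.fst q, mapT 𝕋.T Prod.snd q))]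
  refine iSup_le fun v => iSup_le ?_
  rintro rfl
  rw [Theory.ξ_mapT_ξ, ← mapT_comp, ← mapT_comp]
  have h := Theory.le_lift r (multT 𝕋.T _ v)
  rwa [mapT_multT 𝕋.T Prod.fst, mapT_multT 𝕋.T Prod.snd] at h

/-- The counterpart of `lift_lift_le`: a witness over `m y` comes from one in `T T (X × Y)` because
the naturality square of `m` at the second projection is a weak pullback. -/
theorem Theory.lift_multT_le (r : VRel V X Y) (x : 𝕋.T.obj X) (y : 𝕋.T.obj (𝕋.T.obj Y)) :
    𝕋.lift r x (multT 𝕋.T Y y) ≤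
      ⨆ (x' : 𝕋.T.obj (𝕋.T.obj X)) (_ : multT 𝕋.T X x' = x), 𝕋.lift (𝕋.lift r) x' y := by
  rw [Theory.lift_le_iff]
  rintro w rfl hw
  obtain ⟨v, rfl, rfl⟩ := 𝕋.exists_multT Prod.snd w y hw.symm
  refine le_iSup_of_le (mapT 𝕋.T (mapT 𝕋.T Prod.fst) v)
    (le_iSup_of_le (mapT_multT _ _ _).symm ?_)
  rw [← Theory.ξ_mapT_ξ]
  exact (𝕋.ξ_mono (fun q => Theory.le_lift r q) v).trans
    (Theory.le_lift_map (𝕋.lift r) (mapT 𝕋.T Prod.fst) (mapT 𝕋.T Prod.snd) v)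

end Lift

/-! ### Kleisli convolution -/

section Kleisli

variable {W X Y Z : Type u}

theorem VRel.comp_assoc (t : VRel V Y Z) (s : VRel V X Y) (r : VRel V W X) :
    (t.comp s).comp r = t.comp (s.comp r) := by
  ext w z
  simp only [VRel.comp, Quantale.iSup_mul_distrib, Quantale.mul_iSup_distrib, mul_assoc]
  exact iSup_comm

theorem VRel.comp_mono {s s' : VRel V Y Z} {r r' : VRel V X Y} (hs : s ≤ s') (hr : r ≤ r') :
    s.comp r ≤ s'.comp r' :=
  fun x z => iSup_mono fun y => mul_le_mul' (hr x y) (hs y z)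

theorem VRel.comp_graph_conv (r : VRel V X Y) (f : X → W) (w : W) (y : Y) :
    r.comp (VRel.graph V f).conv w y = ⨆ (x : X) (_ : f x = w), r x y := by
  refine iSup_congr fun x => ?_
  by_cases h : f x = w <;> simp [VRel.conv, VRel.graph, h]

/-- The relation `f°` is the pushforward of the constant `1` along `x ↦ (f x, x)`, and `ξ` preserves
this constant. -/
theorem Theory.lift_graph_conv (f : X → Y) :
    𝕋.lift (VRel.graph V f).conv = (VRel.graph V (mapT 𝕋.T f)).conv := by
  ext y x
  apply le_antisymm
  · rw [Theory.lift_le_iff]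
    rintro w rfl rfl
    have hr : (fun p : Y × X => (VRel.graph V f).conv p.1 p.2) =
        fun p => ⨆ (x : X) (_ : (f x, x) = p), (1 : V) := by
      funext p
      obtain ⟨y, x⟩ := p
      apply le_antisymm
      · by_cases h : f x = y
        · exact le_iSup_of_le x (le_iSup_of_le (by rw [h]) (by simp [VRel.conv, VRel.graph, h]))
        · simp [VRel.conv, VRel.graph, h]
      · refine iSup_le fun x' => iSup_le fun h => ?_
        obtain ⟨h1, rfl⟩ := Prod.ext_iff.1 h
        simp only at h1
        simp [VRel.conv, VRel.graph, h1]
    rw [hr, 𝕋.ξ_natural (fun x => (f x, x))]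
    refine iSup_le fun v => iSup_le ?_
    rintro rfl
    rw [Theory.ξ_const_one, ← mapT_comp, ← mapT_comp, mapT_id]
    simp [VRel.conv, VRel.graph]
  · by_cases h : mapT 𝕋.T f x = y
    · subst h
      have h := Theory.le_lift_map (𝕋 := 𝕋) (VRel.graph V f).conv f (fun x => x) x
      rw [mapT_id] at h
      refine le_trans ?_ h
      simp [VRel.conv, VRel.graph, Theory.ξ_const_one]
    · simp [VRel.conv, VRel.graph, h]

theorem TRel.kleisliLift_apply (α : TRel 𝕋 X Y) (w : 𝕋.T.obj X) (y : 𝕋.T.obj Y) :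
    α.kleisliLift w y = ⨆ (v : 𝕋.T.obj (𝕋.T.obj X)) (_ : multT 𝕋.T X v = w), 𝕋.lift α v y :=
  VRel.comp_graph_conv _ _ _ _

theorem TRel.lift_le_kleisliLift (α : TRel 𝕋 X Y) (w : 𝕋.T.obj (𝕋.T.obj X)) (y : 𝕋.T.obj Y) :
    𝕋.lift α w y ≤ α.kleisliLift (multT 𝕋.T X w) y := by
  rw [TRel.kleisliLift_apply]
  exact le_iSup_of_le w (le_iSup_of_le rfl le_rfl)

theorem TRel.le_kleisliLift_unitT (α : TRel 𝕋 X Y) (w : 𝕋.T.obj X) (y : Y) :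
    α w y ≤ α.kleisliLift w (unitT 𝕋.T Y y) := by
  have h := α.lift_le_kleisliLift (unitT 𝕋.T _ w) (unitT 𝕋.T Y y)
  rw [multT_unitT] at h
  exact (Theory.lift_unit α w y).trans h

theorem TRel.kleisliLift_le_iff (α : TRel 𝕋 X Y) (γ : VRel V (𝕋.T.obj X) (𝕋.T.obj Y)) :
    α.kleisliLift ≤ γ ↔ ∀ w y, 𝕋.lift α w y ≤ γ (multT 𝕋.T X w) y := by
  refine ⟨fun h w y => (α.lift_le_kleisliLift w y).trans (h _ _), fun h w y => ?_⟩
  rw [TRel.kleisliLift_apply]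
  refine iSup_le fun v => iSup_le ?_
  rintro rfl
  exact h v y

theorem TRel.kleisliLift_mapT (α : TRel 𝕋 X Y) (f : Z → Y) (w : 𝕋.T.obj X) (z : 𝕋.T.obj Z) :
    α.kleisliLift w (mapT 𝕋.T f z) =
      TRel.kleisliLift (𝕋 := 𝕋) (fun x z => α x (f z)) w z := by
  simp only [TRel.kleisliLift_apply, Theory.lift_comap_snd]

theorem TRel.kleisliLift_mono {α β : TRel 𝕋 X Y} (h : α ≤ β) :
    α.kleisliLift ≤ β.kleisliLift :=
  VRel.comp_mono (Theory.lift_mono h) le_rfl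

theorem TRel.kleisli_mono {β β' : TRel 𝕋 Y Z} {α α' : TRel 𝕋 X Y} (hβ : β ≤ β') (hα : α ≤ α') :
    β.kleisli α ≤ β'.kleisli α' :=
  VRel.comp_mono hβ (TRel.kleisliLift_mono hα)

theorem TRel.kleisli_le_iff (β : TRel 𝕋 Y Z) (α : TRel 𝕋 X Y) (γ : TRel 𝕋 X Z) :
    β.kleisli α ≤ γ ↔ ∀ w y z, 𝕋.lift α w y * β y z ≤ γ (multT 𝕋.T X w) z := by
  constructor
  · intro h w y z
    exact (mul_le_mul' (α.lift_le_kleisliLift w y) le_rfl).trans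
      ((le_iSup (fun y => α.kleisliLift (multT 𝕋.T X w) y * β y z) y).trans (h _ _))
  · intro h w z
    refine iSup_le fun y => ?_
    rw [TRel.kleisliLift_apply]
    simp only [Quantale.iSup_mul_distrib]
    refine iSup_le fun v => ?_
    by_cases hv : multT 𝕋.T X v = w
    · subst hv
      simpa using h v y z
    · simp [hv]

theorem TRel.lift_kleisliLift (α : TRel 𝕋 X Y) (w : 𝕋.T.obj (𝕋.T.obj X))
    (y : 𝕋.T.obj (𝕋.T.obj Y)) :
    𝕋.lift α.kleisliLift w y =
      ⨆ (v : 𝕋.T.obj (𝕋.T.obj (𝕋.T.obj X))) (_ : mapT 𝕋.T (multT 𝕋.T X) v = w),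
        𝕋.lift (𝕋.lift α) v y := by
  rw [TRel.kleisliLift, Theory.lift_comp, Theory.lift_graph_conv, VRel.comp_graph_conv]

/-- Through this functoriality, associativity of Kleisli convolution is inherited from matrix
multiplication. One inequality uses `lift_lift_le`, the other `lift_multT_le`. -/
theorem TRel.kleisliLift_kleisli (β : TRel 𝕋 Y Z) (α : TRel 𝕋 X Y) :
    (β.kleisli α).kleisliLift = β.kleisliLift.comp α.kleisliLift := by
  apply le_antisymm
  · rw [TRel.kleisliLift_le_iff]
    intro w z
    rw [TRel.kleisli, Theory.lift_comp]
    refine iSup_le fun y => le_iSup_of_le (multT 𝕋.T Y y)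
      (mul_le_mul' ?_ (β.lift_le_kleisliLift y z))
    rw [TRel.lift_kleisliLift]
    refine iSup_le fun v => iSup_le ?_
    rintro rfl
    rw [multT_multT]
    exact (Theory.lift_lift_le α v y).trans (α.lift_le_kleisliLift _ _)
  · intro w z
    refine iSup_le fun y => ?_
    rw [← Quantale.rightMulResiduation_le_iff_mul_le, TRel.kleisliLift_apply]
    refine iSup_le fun y' => iSup_le ?_
    rintro rfl
    rw [Quantale.rightMulResiduation_le_iff_mul_le, mul_comm,
      ← Quantale.rightMulResiduation_le_iff_mul_le, TRel.kleisliLift_apply]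
    refine iSup_le fun w' => iSup_le ?_
    rintro rfl
    refine (Theory.lift_multT_le α w' y').trans (iSup_le fun v => iSup_le ?_)
    rintro rfl
    rw [Quantale.rightMulResiduation_le_iff_mul_le, mul_comm, ← multT_multT]
    refine le_trans ?_ (TRel.lift_le_kleisliLift _ _ _)
    rw [TRel.kleisli, Theory.lift_comp]
    refine le_iSup_of_le y' (mul_le_mul' ?_ le_rfl)
    rw [TRel.lift_kleisliLift]
    exact le_iSup_of_le v (le_iSup_of_le rfl le_rfl)

theorem TRel.kleisli_assoc (γ : TRel 𝕋 Y Z) (β : TRel 𝕋 X Y) (α : TRel 𝕋 W X) :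
    (γ.kleisli β).kleisli α = γ.kleisli (β.kleisli α) := by
  rw [TRel.kleisli, TRel.kleisli, TRel.kleisli, TRel.kleisliLift_kleisli, VRel.comp_assoc]

theorem TRel.extend_kleisli_le (γ : TRel 𝕋 X Z) (α : TRel 𝕋 X Y) :
    (γ.extend α).kleisli α ≤ γ :=
  (TRel.le_extend_iff γ α _).1 le_rfl

theorem TRel.extend_extend (γ : TRel 𝕋 W Z) (α : TRel 𝕋 W X) (β : TRel 𝕋 X Y) :
    (γ.extend α).extend β = γ.extend (β.kleisli α) := by
  apply le_antisymm
  · rw [TRel.le_extend_iff, ← TRel.kleisli_assoc, ← TRel.le_extend_iff, ← TRel.le_extend_iff]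
  · rw [TRel.le_extend_iff, TRel.le_extend_iff, TRel.kleisli_assoc, ← TRel.le_extend_iff]

end Kleisli

/-! ### Discrete `𝕋`-categories and `𝕋`-categories of presheaves -/

theorem TCat.str_kleisli_str (X : TCat 𝕋) : X.str.kleisli X.str ≤ X.str :=
  (TRel.kleisli_le_iff _ _ _).2 X.str_trans

/-- Hence relations out of a discrete `𝕋`-category satisfy the first module condition automatically.
-/
theorem kleisli_graph_unitT_conv {X Y : Type u} (α : TRel 𝕋 X Y) :
    α.kleisli (VRel.graph V (unitT 𝕋.T X)).conv ≤ α := by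
  rw [TRel.kleisli_le_iff]
  intro w x y
  rw [Theory.lift_graph_conv]
  by_cases h : mapT 𝕋.T (unitT 𝕋.T X) x = w
  · subst h
    simp [VRel.conv, VRel.graph, multT_mapT_unitT]
  · simp [VRel.conv, VRel.graph, h]

theorem kleisliLift_graph_unitT_conv {X : Type u} :
    TRel.kleisliLift (𝕋 := 𝕋) (VRel.graph V (unitT 𝕋.T X)).conv =
      (VRel.graph V (fun x : 𝕋.T.obj X => x)).conv := by
  ext w x
  rw [TRel.kleisliLift_apply, Theory.lift_graph_conv]
  apply le_antisymm
  · refine iSup_le fun v => iSup_le ?_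
    rintro rfl
    by_cases h : mapT 𝕋.T (unitT 𝕋.T X) x = v
    · subst h
      simp [VRel.conv, VRel.graph, multT_mapT_unitT]
    · simp [VRel.conv, VRel.graph, h]
  · by_cases h : x = w
    · subst h
      refine le_iSup_of_le _ (le_iSup_of_le (multT_mapT_unitT 𝕋.T x) ?_)
      simp [VRel.conv, VRel.graph]
    · simp [VRel.conv, VRel.graph, h]

variable (𝕋) in
/-- The discrete `𝕋`-category `(S, e_S°)`. -/
noncomputable def TCat.discrete (S : Type u) : TCat 𝕋 where
  carrier := S
  str := (VRel.graph V (unitT 𝕋.T S)).conv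
  one_le_str x := by simp [VRel.conv, VRel.graph]
  str_trans := (TRel.kleisli_le_iff _ _ _).1 (kleisli_graph_unitT_conv _)

/-- A function out of a set, as a `𝕋`-functor out of the discrete `𝕋`-category. -/
noncomputable def TFunctor.ofDiscrete {S : Type u} (X : TCat 𝕋) (f : S → X) :
    TFunctor (TCat.discrete 𝕋 S) X where
  toFun := f
  str_le (w : 𝕋.T.obj S) (x : S) := by
    by_cases h : unitT 𝕋.T S x = w
    · subst h
      refine le_trans ?_ ((X.one_le_str (f x)).trans_eq
        (congrArg (X.str · (f x)) (mapT_unitT 𝕋.T f x).symm))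
      simp [TCat.discrete, VRel.conv, VRel.graph]
    · simp [TCat.discrete, VRel.conv, VRel.graph, h]

theorem TCat.IsLSeparated.eq_of_le {X : TCat 𝕋} (hX : X.IsLSeparated) {x y : X}
    (hxy : 1 ≤ X.str (unitT 𝕋.T X x) y) (hyx : 1 ≤ X.str (unitT 𝕋.T X y) x) : x = y := by
  have h := hX _ (TFunctor.ofDiscrete X (fun _ : PUnit.{u + 1} => x))
    (TFunctor.ofDiscrete X (fun _ => y)) ((TFunctor.le_iff _ _).2 fun _ => hxy)
    ((TFunctor.le_iff _ _).2 fun _ => hyx)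
  exact congrFun (congrArg TFunctor.toFun h) PUnit.unit

theorem TCat.isLSeparated_of_eq_of_le {X : TCat 𝕋}
    (hX : ∀ x y : X, 1 ≤ X.str (unitT 𝕋.T X x) y → 1 ≤ X.str (unitT 𝕋.T X y) x → x = y) :
    X.IsLSeparated := fun _ f g hfg hgf =>
  TFunctor.ext (funext fun x =>
    hX _ _ ((TFunctor.le_iff f g).1 hfg x) ((TFunctor.le_iff g f).1 hgf x))

theorem TCat.IsLSeparated.eq_of_str_eq {X : TCat 𝕋} (hX : X.IsLSeparated) {x y : X}
    (h : ∀ z, X.str (unitT 𝕋.T X x) z = X.str (unitT 𝕋.T X y) z) : x = y :=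
  hX.eq_of_le (h y ▸ X.one_le_str y) (h x ▸ X.one_le_str x)

variable (𝕋) in
/-- The presheaves on the discrete `𝕋`-category `S`, that is, the modules from `S` to the discrete
one-point `𝕋`-category. -/
def Presheaf (S : Type u) : Type u :=
  {φ : 𝕋.T.obj S → V // ∀ w : 𝕋.T.obj (𝕋.T.obj S),
    𝕋.lift (fun x (_ : PUnit.{u + 1}) => φ x) w (unitT 𝕋.T _ PUnit.unit) ≤ φ (multT 𝕋.T S w)}

variable (𝕋) in
/-- The evaluation of presheaves, as a `𝕋`-relation. -/
def Presheaf.eval (S : Type u) : TRel 𝕋 S (Presheaf 𝕋 S) :=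
  fun w φ => φ.1 w

/-- With this, `𝕋`-functors `Z → P S` become relations `α` from `S` to `Z` with `Z.str ∘ α ≤ α`, by
the adjunction defining extensions. -/
theorem Presheaf.extend_eval_mapT {S Z : Type u} (f : Z → Presheaf 𝕋 S) {Y : Type u}
    (γ : TRel 𝕋 S Y) (z : 𝕋.T.obj Z) (y : Y) :
    γ.extend (Presheaf.eval 𝕋 S) (mapT 𝕋.T f z) y =
      γ.extend (𝕋 := 𝕋) (fun w z => (f z).1 w) z y := by
  refine iInf_congr fun w => ?_
  rw [TRel.kleisliLift_mapT]
  rfl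

/-- The bound `≤` is exactly the module condition on `φ`. It makes the underlying order of `P S`
pointwise, whence L-separation. -/
theorem Presheaf.kleisliLift_eval_unitT {S : Type u} (φ : Presheaf 𝕋 S) (w : 𝕋.T.obj S) :
    (Presheaf.eval 𝕋 S).kleisliLift w (unitT 𝕋.T _ φ) = φ.1 w := by
  apply le_antisymm
  · rw [← mapT_unitT 𝕋.T (fun _ : PUnit.{u + 1} => φ) PUnit.unit, TRel.kleisliLift_mapT,
      TRel.kleisliLift_apply]
    refine iSup_le fun v => iSup_le ?_
    rintro rfl
    exact φ.2 v
  · exact TRel.le_kleisliLift_unitT (Presheaf.eval 𝕋 S) w φ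

variable (𝕋) in
/-- The `𝕋`-category of presheaves on the discrete `𝕋`-category `S`. -/
noncomputable def TCat.presheaf (S : Type u) : TCat 𝕋 where
  carrier := Presheaf 𝕋 S
  str := (Presheaf.eval 𝕋 S).extend (Presheaf.eval 𝕋 S)
  one_le_str φ := le_iInf fun w => by
    rw [Quantale.rightMulResiduation_le_iff_mul_le, mul_one, Presheaf.kleisliLift_eval_unitT]
    rfl
  str_trans := (TRel.kleisli_le_iff _ _ _).1 <| by
    rw [TRel.le_extend_iff, TRel.kleisli_assoc]
    exact (TRel.kleisli_mono le_rfl (TRel.extend_kleisli_le _ _)).trans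
      (TRel.extend_kleisli_le _ _)

theorem Presheaf.one_le_str_iff {S : Type u} (φ ψ : TCat.presheaf 𝕋 S) :
    1 ≤ (TCat.presheaf 𝕋 S).str (unitT 𝕋.T _ φ) ψ ↔ φ.1 ≤ ψ.1 := by
  refine le_iInf_iff.trans (forall_congr' fun w => ?_)
  rw [Quantale.rightMulResiduation_le_iff_mul_le, mul_one]
  exact iff_of_eq (congrArg (· ≤ ψ.1 w) (Presheaf.kleisliLift_eval_unitT φ w))

theorem TCat.presheaf_isLSeparated (S : Type u) : (TCat.presheaf 𝕋 S).IsLSeparated :=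
  TCat.isLSeparated_of_eq_of_le fun φ ψ h1 h2 => Subtype.ext
    (le_antisymm ((Presheaf.one_le_str_iff φ ψ).1 h1) ((Presheaf.one_le_str_iff ψ φ).1 h2))

/-- A module out of a discrete `𝕋`-category, as a family of presheaves. -/
def Presheaf.mate {S : Type u} {Z : TCat 𝕋} (φ : TRel 𝕋 S Z) (hφ : Z.str.kleisli φ ≤ φ) (z : Z) :
    Presheaf 𝕋 S :=
  ⟨fun w => φ w z, fun w => by
    rw [← Theory.lift_comap_snd φ (fun _ : PUnit.{u + 1} => z), mapT_unitT]
    have h := (TRel.kleisli_le_iff _ _ _).1 hφ w (unitT 𝕋.T Z z) z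
    exact (le_mul_of_one_le_right' (Z.one_le_str z)).trans h⟩

/-- The `𝕋`-functor into presheaves corresponding to a module out of a discrete `𝕋`-category. -/
noncomputable def TFunctor.mate {S : Type u} {Z : TCat 𝕋} (φ : TRel 𝕋 S Z)
    (hφ : Z.str.kleisli φ ≤ φ) : TFunctor Z (TCat.presheaf 𝕋 S) where
  toFun := Presheaf.mate φ hφ
  str_le w x := ((TRel.le_extend_iff φ φ _).2 hφ w x).trans_eq
    (Presheaf.extend_eval_mapT (Presheaf.mate φ hφ) (Presheaf.eval 𝕋 S) w
      (Presheaf.mate φ hφ x)).symm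

theorem TFunctor.str_kleisli_presheaf {S : Type u} {Z : TCat 𝕋}
    (f : TFunctor Z (TCat.presheaf 𝕋 S)) :
    Z.str.kleisli (𝕋 := 𝕋) (fun w z => (f.toFun z).1 w) ≤ fun w z => (f.toFun z).1 w := by
  rw [← TRel.le_extend_iff]
  intro w z
  refine (f.str_le w z).trans_eq ?_
  exact Presheaf.extend_eval_mapT (Z := Z) f.toFun (Presheaf.eval 𝕋 S) w _

/-- If `α` is the relation corresponding to `h`, the colimit corresponds to `ψ ∘ α`, since extending
along `α` and then along `ψ` is extending along `ψ ∘ α`. -/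
theorem TCat.presheaf_isCocomplete (S : Type u) : (TCat.presheaf 𝕋 S).IsCocomplete := by
  intro Y Z h ψ hψ
  let α : TRel 𝕋 S Y := fun w y => (h.toFun y).1 w
  have hα : Y.str.kleisli α ≤ α := h.str_kleisli_presheaf
  refine ⟨TFunctor.mate (ψ.kleisli α) ?_, ?_⟩
  · rw [← TRel.kleisli_assoc]
    exact TRel.kleisli_mono hψ.2 le_rfl
  · have hh : h.lowerStar = (Presheaf.eval 𝕋 S).extend α := by
      ext w φ
      exact Presheaf.extend_eval_mapT (Z := Y) h.toFun (Presheaf.eval 𝕋 S) w φ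
    refine Eq.trans ?_ ((congrArg (TRel.extend · ψ) hh).trans (TRel.extend_extend _ α ψ)).symm
    ext w φ
    exact Presheaf.extend_eval_mapT (Z := Z) _ (Presheaf.eval 𝕋 S) w φ

/-! ### The underlying order and adjunctions -/

/-- The underlying order of a `𝕋`-category. -/
def TCat.Below (X : TCat 𝕋) (x y : X) : Prop :=
  1 ≤ X.str (unitT 𝕋.T X x) y

theorem TCat.Below.refl {X : TCat 𝕋} (x : X) : X.Below x x :=
  X.one_le_str x

theorem TCat.Below.map {X Y : TCat 𝕋} (f : TFunctor X Y) {x y : X} (h : X.Below x y) :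
    Y.Below (f.toFun x) (f.toFun y) := by
  have := f.str_le (unitT 𝕋.T X x) y
  rw [mapT_unitT] at this
  exact le_trans h this

/-- The pointwise bound `1 ≤ b(e(f x), g x)` passes through `ξ`, which preserves the constant `1`;
transitivity of `b` finishes. -/
theorem TFunctor.lowerStar_antitone {X Y : TCat 𝕋} {f g : TFunctor X Y} (h : f ≤ g) :
    g.lowerStar ≤ f.lowerStar := by
  intro w y
  rw [TFunctor.le_iff] at h
  have h1 : 1 ≤ 𝕋.lift Y.str (mapT 𝕋.T (unitT 𝕋.T Y) (mapT 𝕋.T f.toFun w))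
      (mapT 𝕋.T g.toFun w) := by
    rw [← mapT_comp, ← Theory.ξ_const_one (𝕋 := 𝕋) w]
    exact (𝕋.ξ_mono (fun x => h x) w).trans
      (Theory.le_lift_map Y.str (fun x => unitT 𝕋.T Y (f.toFun x)) g.toFun w)
  refine (le_mul_of_one_le_left' h1).trans ((Y.str_trans _ _ y).trans_eq ?_)
  rw [multT_mapT_unitT]
  rfl

/-- `l` is left adjoint to `r`, in terms of the structures of `𝕋`-categories. -/
def TFunctor.Adj {X Y : TCat 𝕋} (l : TFunctor X Y) (r : TFunctor Y X) : Prop :=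
  ∀ (w : 𝕋.T.obj X) (y : Y), Y.str (mapT 𝕋.T l.toFun w) y = X.str w (r.toFun y)

namespace TFunctor.Adj

variable {X Y : TCat 𝕋} {l : TFunctor X Y} {r : TFunctor Y X}

theorem below_iff (h : l.Adj r) (x : X) (y : Y) :
    Y.Below (l.toFun x) y ↔ X.Below x (r.toFun y) := by
  rw [TCat.Below, TCat.Below, ← h, mapT_unitT]

theorem unit (h : l.Adj r) (x : X) : X.Below x (r.toFun (l.toFun x)) :=
  (h.below_iff _ _).1 (TCat.Below.refl _)

theorem counit (h : l.Adj r) (y : Y) : Y.Below (l.toFun (r.toFun y)) y :=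
  (h.below_iff _ _).2 (TCat.Below.refl _)

theorem isLeftAdjoint (h : l.Adj r) : l.IsLeftAdjoint :=
  ⟨r, (TFunctor.le_iff _ _).2 h.unit, (TFunctor.le_iff _ _).2 h.counit⟩

theorem left_right_left (h : l.Adj r) (hY : Y.IsLSeparated) (x : X) :
    l.toFun (r.toFun (l.toFun x)) = l.toFun x :=
  hY.eq_of_le (h.counit _) ((h.unit x).map l)

theorem left_unique (hY : Y.IsLSeparated) (h : l.Adj r) {l' : TFunctor X Y} {r' : TFunctor Y X}
    (h' : l'.Adj r') (hr : ∀ y, r.toFun y = r'.toFun y) : l = l' := by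
  refine TFunctor.ext (funext fun x => hY.eq_of_str_eq fun y => ?_)
  rw [← mapT_unitT, ← mapT_unitT, h, h', hr]

end TFunctor.Adj

theorem TFunctor.isLeftAdjoint_iff {X Y : TCat 𝕋} {l : TFunctor X Y} :
    l.IsLeftAdjoint ↔ ∃ r : TFunctor Y X, l.Adj r := by
  refine ⟨?_, fun ⟨r, h⟩ => h.isLeftAdjoint⟩
  rintro ⟨r, hu, hc⟩
  refine ⟨r, fun w y => le_antisymm ?_ ?_⟩
  · refine (r.str_le _ y).trans ?_
    have h := TFunctor.lowerStar_antitone hu w (r.toFun y)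
    rw [TFunctor.lowerStar, TFunctor.lowerStar, TFunctor.id, mapT_id, TFunctor.comp,
      mapT_comp 𝕋.T r.toFun l.toFun] at h
    exact h
  · exact (l.str_le w (r.toFun y)).trans (hc _ y)

/-! ### The universal property of presheaves -/

theorem TCat.str_kleisli_comap_le {S : Type u} (X : TCat 𝕋) (h : S → X) :
    X.str.kleisli (𝕋 := 𝕋) (fun w x => X.str (mapT 𝕋.T h w) x) ≤
      fun w x => X.str (mapT 𝕋.T h w) x := by
  rw [TRel.kleisli_le_iff]
  intro w y z
  refine (mul_le_mul' (Theory.lift_comap_fst_le X.str (mapT 𝕋.T h) w y) le_rfl).trans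
    ((X.str_trans _ y z).trans_eq ?_)
  rw [mapT_multT]

/-- The nerve `X → P S` of a function `h : S → X`. -/
noncomputable def TFunctor.nerve {S : Type u} {X : TCat 𝕋} (h : S → X) :
    TFunctor X (TCat.presheaf 𝕋 S) :=
  TFunctor.mate (fun w x => X.str (mapT 𝕋.T h w) x) (X.str_kleisli_comap_le h)

variable (𝕋) in
/-- The Yoneda embedding of a discrete `𝕋`-category. -/
noncomputable def TFunctor.yoneda (S : Type u) :
    TFunctor (TCat.discrete 𝕋 S) (TCat.presheaf 𝕋 S) :=
  TFunctor.mate (TCat.discrete 𝕋 S).str (TCat.discrete 𝕋 S).str_kleisli_str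

/-- The Yoneda lemma: the Kleisli lift of the discrete structure is the identity relation, so only
the term `v = w` of the infimum matters. -/
theorem TFunctor.str_mapT_yoneda {S : Type u} (w : 𝕋.T.obj S) (φ : TCat.presheaf 𝕋 S) :
    (TCat.presheaf 𝕋 S).str (mapT 𝕋.T (TFunctor.yoneda 𝕋 S).toFun w) φ = φ.1 w := by
  refine (Presheaf.extend_eval_mapT (Z := S) (TFunctor.yoneda 𝕋 S).toFun
    (Presheaf.eval 𝕋 S) w φ).trans ?_
  change (⨅ v, TRel.kleisliLift (𝕋 := 𝕋) (VRel.graph V (unitT 𝕋.T S)).conv v w ⇨ᵣ φ.1 v) = φ.1 w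
  rw [kleisliLift_graph_unitT_conv]
  apply le_antisymm
  · refine (iInf_le _ w).trans ?_
    have h := (Quantale.rightMulResiduation_le_iff_mul_le
      (x := (VRel.graph V (fun x : 𝕋.T.obj S => x)).conv w w ⇨ᵣ φ.1 w)).1 le_rfl
    simpa [VRel.conv, VRel.graph] using h
  · refine le_iInf fun v => ?_
    rw [Quantale.rightMulResiduation_le_iff_mul_le]
    by_cases h : w = v
    · subst h
      simp [VRel.conv, VRel.graph]
    · simp [VRel.conv, VRel.graph, h]

theorem isModule_eval (S : Type u) :
    IsModule (TCat.discrete 𝕋 S) (TCat.presheaf 𝕋 S) (Presheaf.eval 𝕋 S) :=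
  ⟨kleisli_graph_unitT_conv _, TRel.extend_kleisli_le _ _⟩

/-- The nerve of a function into a cocomplete `𝕋`-category has a left adjoint, the left Kan
extension along the Yoneda embedding. -/
theorem TCat.IsCocomplete.exists_adj_nerve {X : TCat 𝕋} (hX : X.IsCocomplete) {S : Type u}
    (h : S → X) : ∃ l : TFunctor (TCat.presheaf 𝕋 S) X, l.Adj (TFunctor.nerve h) := by
  obtain ⟨l, hl⟩ := hX _ _ (TFunctor.ofDiscrete X h) _ (isModule_eval S)
  exact ⟨l, fun w x => congrFun (congrFun hl w) x⟩

theorem TFunctor.Adj.nerve_yoneda {X : TCat 𝕋} (hX : X.IsLSeparated) {S : Type u} {h : S → X}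
    {l : TFunctor (TCat.presheaf 𝕋 S) X} (hl : l.Adj (TFunctor.nerve h)) (s : S) :
    l.toFun ((TFunctor.yoneda 𝕋 S).toFun s) = h s := by
  refine hX.eq_of_str_eq fun x => ?_
  rw [← mapT_unitT, hl, ← mapT_unitT 𝕋.T h]
  refine Eq.trans ?_ (TFunctor.str_mapT_yoneda (unitT 𝕋.T S s) ((TFunctor.nerve h).toFun x))
  exact congrArg (fun w => (TCat.presheaf 𝕋 S).str w ((TFunctor.nerve h).toFun x))
    (mapT_unitT 𝕋.T (TFunctor.yoneda 𝕋 S).toFun s).symm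

/-- By Yoneda, `r x` at `w` is `P S(T y w, r x)` with `y` the Yoneda embedding, and this is `X(T (l
y) w, x)` by adjunction. -/
theorem TFunctor.Adj.right_eq_nerve {X : TCat 𝕋} {S : Type u}
    {l : TFunctor (TCat.presheaf 𝕋 S) X} {r : TFunctor X (TCat.presheaf 𝕋 S)} (h : l.Adj r)
    (x : X) :
    r.toFun x = (TFunctor.nerve fun s => l.toFun ((TFunctor.yoneda 𝕋 S).toFun s)).toFun x := by
  refine Subtype.ext (funext fun w => ?_)
  rw [← TFunctor.str_mapT_yoneda, ← h]
  exact congrArg (X.str · x) (mapT_comp 𝕋.T l.toFun (TFunctor.yoneda 𝕋 S).toFun w).symm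

theorem TFunctor.Adj.eq_of_yoneda {X : TCat 𝕋} (hX : X.IsLSeparated) {S : Type u}
    {l l' : TFunctor (TCat.presheaf 𝕋 S) X} {r r' : TFunctor X (TCat.presheaf 𝕋 S)}
    (h : l.Adj r) (h' : l'.Adj r')
    (hs : ∀ s, l.toFun ((TFunctor.yoneda 𝕋 S).toFun s) =
      l'.toFun ((TFunctor.yoneda 𝕋 S).toFun s)) : l = l' := by
  refine TFunctor.Adj.left_unique hX h h' fun x => ?_
  rw [h.right_eq_nerve, h'.right_eq_nerve]
  exact congrArg (fun h : S → X => (TFunctor.nerve h).toFun x) (funext hs)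

/-! ### Fixed points of closure operators -/

/-- The `𝕋`-category structure on `S` induced by a function `f : S → X`. -/
def TCat.induced {S : Type u} (X : TCat 𝕋) (f : S → X) : TCat 𝕋 where
  carrier := S
  str w s := X.str (mapT 𝕋.T f w) (f s)
  one_le_str s := by
    rw [mapT_unitT]
    exact X.one_le_str _
  str_trans W w s := by
    rw [mapT_multT]
    refine le_trans (mul_le_mul' ?_ le_rfl) (X.str_trans _ (mapT 𝕋.T f w) _)
    rw [Theory.lift_comap_snd]
    exact Theory.lift_comap_fst_le (fun v s => X.str v (f s)) (mapT 𝕋.T f) W w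

/-- A closure operator on a `𝕋`-category. -/
structure TFunctor.IsClosure {X : TCat 𝕋} (d : TFunctor X X) : Prop where
  below (x : X) : X.Below x (d.toFun x)
  idem (x : X) : d.toFun (d.toFun x) = d.toFun x

/-- The full subcategory of fixed points. -/
def TFunctor.fixed {X : TCat 𝕋} (d : TFunctor X X) : TCat 𝕋 :=
  X.induced (Subtype.val : {x : X // d.toFun x = x} → X)

/-- The inclusion of the fixed points. -/
def TFunctor.fixedIncl {X : TCat 𝕋} (d : TFunctor X X) : TFunctor d.fixed X where
  toFun := Subtype.val
  str_le _ _ := le_rfl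

/-- The corestriction to the fixed points of a `𝕋`-functor whose values are fixed. -/
def TFunctor.fixedLift {X Y : TCat 𝕋} (d : TFunctor X X) (f : TFunctor Y X)
    (hf : ∀ y, d.toFun (f.toFun y) = f.toFun y) : TFunctor Y d.fixed where
  toFun y := ⟨f.toFun y, hf y⟩
  str_le w y := (f.str_le w y).trans_eq <| congrArg (X.str · (f.toFun y)) <|
    mapT_comp 𝕋.T (Subtype.val : {x : X // d.toFun x = x} → X) (fun y => ⟨f.toFun y, hf y⟩) w

namespace TFunctor.IsClosure

variable {X : TCat 𝕋} {d : TFunctor X X}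

theorem str_mapT (hd : d.IsClosure) (w : 𝕋.T.obj X) {x : X} (hx : d.toFun x = x) :
    X.str (mapT 𝕋.T d.toFun w) x = X.str w x := by
  apply le_antisymm
  · have h : TFunctor.id X ≤ d := (TFunctor.le_iff _ _).2 hd.below
    refine (TFunctor.lowerStar_antitone h w x).trans_eq ?_
    rw [TFunctor.lowerStar, TFunctor.id, mapT_id]
  · have h := d.str_le w x
    rwa [hx] at h

theorem adj (hd : d.IsClosure) : (d.fixedLift d hd.idem).Adj d.fixedIncl := fun w x =>
  (congrArg (X.str · x.1) (mapT_comp 𝕋.T (Subtype.val : {x : X // d.toFun x = x} → X)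
    (d.fixedLift d hd.idem).toFun w)).symm.trans (hd.str_mapT w x.2)

theorem desc_adj (hd : d.IsClosure) (hX : X.IsLSeparated) {Z : TCat 𝕋} {k : TFunctor X Z} {r : TFunctor Z X}
    (h : k.Adj r) (hk : ∀ x, k.toFun (d.toFun x) = k.toFun x) :
    ∃ r' : TFunctor Z d.fixed, (k.comp d.fixedIncl).Adj r' ∧
      ∀ z, d.fixedIncl.toFun (r'.toFun z) = r.toFun z := by
  -- Since `k d r = k r ≤ 1`, adjunction gives `d r ≤ r`, so `r` takes fixed values.
  have hr : ∀ z, d.toFun (r.toFun z) = r.toFun z := fun z => by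
    refine hX.eq_of_le ((h.below_iff _ _).1 ?_) (hd.below _)
    rw [hk]
    exact h.counit z
  refine ⟨d.fixedLift r hr, fun w z => ?_, fun z => rfl⟩
  refine Eq.trans ?_ (h (mapT 𝕋.T Subtype.val w) z)
  exact congrArg (Z.str · z) (mapT_comp 𝕋.T k.toFun Subtype.val w)

theorem _root_.TopTheory.TFunctor.fixed_isLSeparated (hX : X.IsLSeparated) : d.fixed.IsLSeparated :=
  TCat.isLSeparated_of_eq_of_le fun _ _ hxy hyx =>
    Subtype.ext (hX.eq_of_le (TCat.Below.map d.fixedIncl hxy) (TCat.Below.map d.fixedIncl hyx))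

/-- Colimits are computed in `X` and then reflected by `d`. -/
theorem fixed_isCocomplete (hd : d.IsClosure) (hX : X.IsCocomplete) : d.fixed.IsCocomplete := by
  intro Y Z h ψ hψ
  obtain ⟨g, hg⟩ := hX Y Z (d.fixedIncl.comp h) ψ hψ
  refine ⟨(d.fixedLift d hd.idem).comp g, ?_⟩
  ext w x
  refine Eq.trans ?_ ((congrFun (congrFun hg w) x.1).trans ?_)
  · refine Eq.trans ?_ (hd.adj (mapT 𝕋.T g.toFun w) x)
    exact congrArg (d.fixed.str · x) (mapT_comp 𝕋.T (d.fixedLift d hd.idem).toFun g.toFun w)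
  · refine iInf_congr fun v => congrArg (ψ.kleisliLift v w ⇨ᵣ ·) ?_
    exact congrArg (X.str · x.1) (mapT_comp 𝕋.T Subtype.val h.toFun v)

end TFunctor.IsClosure

/-! ### The category of L-separated cocomplete `𝕋`-categories -/

namespace CocomplSep

@[ext]
theorem hom_ext {X Y : CocomplSep 𝕋} {f g : X ⟶ Y}
    (h : ∀ x, f.toTFunctor.toFun x = g.toTFunctor.toFun x) : f = g :=
  CocomplSep.Hom.ext (TFunctor.ext (funext h))

theorem exists_adj {X Y : CocomplSep 𝕋} (f : X ⟶ Y) :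
    ∃ r : TFunctor Y.toTCat X.toTCat, f.toTFunctor.Adj r :=
  TFunctor.isLeftAdjoint_iff.1 f.isLeftAdjoint

theorem congr_toFun {X Y : CocomplSep 𝕋} {f g : X ⟶ Y} (h : f = g) (x : X.toTCat) :
    f.toTFunctor.toFun x = g.toTFunctor.toFun x := by
  rw [h]

/-- The presheaves on a discrete `𝕋`-category. -/
noncomputable def free (𝕋 : Theory V) (S : Type u) : CocomplSep 𝕋 where
  toTCat := TCat.presheaf 𝕋 S
  isLSeparated := TCat.presheaf_isLSeparated S
  isCocomplete := TCat.presheaf_isCocomplete S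

/-- The extension of a function along the Yoneda embedding. -/
noncomputable def freeDesc {S : Type u} {X : CocomplSep 𝕋} (h : S → X.toTCat) : free 𝕋 S ⟶ X :=
  ⟨(X.isCocomplete.exists_adj_nerve h).choose,
    (X.isCocomplete.exists_adj_nerve h).choose_spec.isLeftAdjoint⟩

theorem freeDesc_yoneda {S : Type u} {X : CocomplSep 𝕋} (h : S → X.toTCat) (s : S) :
    (freeDesc h).toTFunctor.toFun ((TFunctor.yoneda 𝕋 S).toFun s) = h s :=
  (X.isCocomplete.exists_adj_nerve h).choose_spec.nerve_yoneda X.isLSeparated s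

theorem free_hom_ext {S : Type u} {X : CocomplSep 𝕋} {f g : free 𝕋 S ⟶ X}
    (h : ∀ s, f.toTFunctor.toFun ((TFunctor.yoneda 𝕋 S).toFun s) =
      g.toTFunctor.toFun ((TFunctor.yoneda 𝕋 S).toFun s)) : f = g := by
  obtain ⟨r, hr⟩ := exists_adj f
  obtain ⟨r', hr'⟩ := exists_adj g
  exact CocomplSep.Hom.ext (hr.eq_of_yoneda X.isLSeparated hr' h)

/-- The universal property of `free`. -/
noncomputable def freeEquiv (S : Type u) (X : CocomplSep 𝕋) :
    (free 𝕋 S ⟶ X) ≃ (S ⟶ (forget 𝕋).obj X) where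
  toFun f := ↾(fun s => f.toTFunctor.toFun ((TFunctor.yoneda 𝕋 S).toFun s))
  invFun h := freeDesc (X := X) (fun s => h s)
  left_inv f := free_hom_ext fun s => freeDesc_yoneda _ s
  right_inv h := by
    ext s
    exact freeDesc_yoneda _ s

/-- The adjunction between `free` and the forgetful functor. -/
noncomputable def adjunction (𝕋 : Theory V) :
    Adjunction.leftAdjointOfEquiv (G := forget 𝕋) freeEquiv (fun _ _ _ _ _ => rfl) ⊣ forget 𝕋 :=
  Adjunction.adjunctionOfEquivLeft _ _

/-- For a bijective `f` with right adjoint `r`, cancelling in `f r f = f` shows that `r` is the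
inverse of `f`; substitution then makes `r` itself left adjoint to `f`. -/
instance : (forget 𝕋).ReflectsIsomorphisms where
  reflects {X Y} f hf := by
    obtain ⟨r, hr⟩ := exists_adj f
    have hb : Function.Bijective f.toTFunctor.toFun :=
      (isIso_iff_bijective ((forget 𝕋).map f)).1 hf
    have h1 : ∀ x, r.toFun (f.toTFunctor.toFun x) = x := fun x =>
      hb.1 (hr.left_right_left Y.isLSeparated x)
    have h2 : ∀ y, f.toTFunctor.toFun (r.toFun y) = y := fun y => by
      obtain ⟨x, rfl⟩ := hb.2 y
      rw [h1]
    have hr' : r.Adj f.toTFunctor := fun w x => by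
      have h := hr (mapT 𝕋.T r.toFun w) (f.toTFunctor.toFun x)
      rw [h1, ← mapT_comp] at h
      simp only [h2, mapT_id] at h
      exact h.symm
    exact ⟨⟨⟨r, hr'.isLeftAdjoint⟩, hom_ext h1, hom_ext h2⟩⟩

/-- The fixed points of a closure operator. -/
def fixed (X : CocomplSep 𝕋) {d : TFunctor X.toTCat X.toTCat} (hd : d.IsClosure) :
    CocomplSep 𝕋 where
  toTCat := d.fixed
  isLSeparated := TFunctor.fixed_isLSeparated X.isLSeparated
  isCocomplete := hd.fixed_isCocomplete X.isCocomplete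

/-- The reflection onto the fixed points. -/
def fixedProj (X : CocomplSep 𝕋) {d : TFunctor X.toTCat X.toTCat} (hd : d.IsClosure) :
    X ⟶ X.fixed hd :=
  ⟨d.fixedLift d hd.idem, hd.adj.isLeftAdjoint⟩

/-- The morphism on the fixed points induced by a morphism that inverts the closure operator. -/
def fixedDesc (X : CocomplSep 𝕋) {d : TFunctor X.toTCat X.toTCat} (hd : d.IsClosure)
    {Z : CocomplSep 𝕋} (k : X ⟶ Z)
    (hk : ∀ x, k.toTFunctor.toFun (d.toFun x) = k.toTFunctor.toFun x) : X.fixed hd ⟶ Z :=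
  ⟨k.toTFunctor.comp d.fixedIncl, by
    obtain ⟨r, hr⟩ := exists_adj k
    obtain ⟨r', hr', -⟩ := hd.desc_adj X.isLSeparated hr hk
    exact hr'.isLeftAdjoint⟩

/-- A pair split in sets determines a closure operator on its codomain, whose values are the
largest elements of the equivalence classes. -/
theorem exists_isClosure {X Y : CocomplSep 𝕋} (f g : X ⟶ Y) {Q : Type u}
    (q : Y.toTCat → Q) (s : Q → Y.toTCat) (t : Y.toTCat → X.toTCat)
    (hq : ∀ x, q (f.toTFunctor.toFun x) = q (g.toTFunctor.toFun x))
    (hg : ∀ y, g.toTFunctor.toFun (t y) = y) (hf : ∀ y, f.toTFunctor.toFun (t y) = s (q y)) :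
    ∃ d : TFunctor Y.toTCat Y.toTCat, d.IsClosure ∧
      (∀ y y', q y = q y' ↔ d.toFun y = d.toFun y') ∧
      ∀ {Z : CocomplSep 𝕋} (k : Y ⟶ Z), f ≫ k = g ≫ k →
        ∀ y, k.toTFunctor.toFun (d.toFun y) = k.toTFunctor.toFun y := by
  obtain ⟨f', hf'⟩ := exists_adj f
  obtain ⟨g', hg'⟩ := exists_adj g
  have htg : ∀ y, X.toTCat.Below (t y) (g'.toFun y) := fun y => by
    rw [← hg'.below_iff, hg]
    exact TCat.Below.refl _
  -- From `g t = 1` follows `t ≤ g'`, so `y = g t y ≤ g g' y ≤ y`.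
  have hgg : ∀ y, g.toTFunctor.toFun (g'.toFun y) = y := fun y => by
    refine Y.isLSeparated.eq_of_le (hg'.counit y) ?_
    have h := (htg y).map g.toTFunctor
    rwa [hg] at h
  let d := g.toTFunctor.comp (f'.comp (f.toTFunctor.comp g'))
  have hd : ∀ y, Y.toTCat.Below y (d.toFun y) := fun y => by
    have h := (hf'.unit (g'.toFun y)).map g.toTFunctor
    rwa [hgg] at h
  -- Trade `g` for `f` under `q`, use `f f' f = f`, and trade back: `q d = q f f' f g' = q f g' = q
  -- g g' = q`.
  have hqd : ∀ y, q (d.toFun y) = q y := fun y => by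
    refine (hq _).symm.trans ?_
    refine (congrArg q (hf'.left_right_left Y.isLSeparated (g'.toFun y))).trans ?_
    rw [hq, hgg]
  -- If `q y = q y'`, then `f t y' = s q y = f t y ≤ f g' y`, so `t y' ≤ f' f g' y`; now apply `g`.
  have hle : ∀ y y', q y = q y' → Y.toTCat.Below y' (d.toFun y) := fun y y' h => by
    have h1 : Y.toTCat.Below (f.toTFunctor.toFun (t y')) (f.toTFunctor.toFun (g'.toFun y)) := by
      rw [hf, ← h, ← hf]
      exact (htg y).map f.toTFunctor
    have h2 := ((hf'.below_iff _ _).1 h1).map g.toTFunctor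
    rwa [hg] at h2
  have hdq : ∀ y y', q y = q y' → d.toFun y = d.toFun y' := fun y y' h =>
    Y.isLSeparated.eq_of_le (hle y' _ (h.symm.trans (hqd y).symm))
      (hle y _ (h.trans (hqd y').symm))
  refine ⟨d, ⟨hd, fun y => hdq _ _ (hqd y)⟩, fun y y' => ⟨hdq y y', fun h => ?_⟩, ?_⟩
  · rw [← hqd y, h, hqd]
  · intro Z k hk y
    refine (congr_toFun hk _).symm.trans ?_
    refine (congrArg k.toTFunctor.toFun
      (hf'.left_right_left Y.isLSeparated (g'.toFun y))).trans ?_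
    refine (congr_toFun hk _).trans (congrArg k.toTFunctor.toFun (hgg y))

theorem exists_isColimit_of_isSplitPair {X Y : CocomplSep 𝕋} (f g : X ⟶ Y)
    [(forget 𝕋).IsSplitPair f g] :
    ∃ c : Cofork f g, Nonempty (IsColimit c) ∧ Nonempty (IsColimit ((forget 𝕋).mapCocone c)) := by
  obtain ⟨Q, q, ⟨hs⟩⟩ := HasSplitCoequalizer.splittable (f := (forget 𝕋).map f)
    (g := (forget 𝕋).map g)
  have hsq := ConcreteCategory.congr_hom hs.rightSection_π
  have hgt := ConcreteCategory.congr_hom hs.leftSection_bottom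
  have hft := ConcreteCategory.congr_hom hs.leftSection_top
  obtain ⟨d, hd, hqd, hk⟩ := exists_isClosure f g q hs.rightSection hs.leftSection
    (ConcreteCategory.congr_hom hs.condition) hgt hft
  have hw : f ≫ Y.fixedProj hd = g ≫ Y.fixedProj hd := hom_ext fun x =>
    Subtype.ext ((hqd _ _).1 (ConcreteCategory.congr_hom hs.condition x))
  refine ⟨Cofork.ofπ (Y.fixedProj hd) hw, ⟨?_⟩, ⟨?_⟩⟩
  · refine Cofork.IsColimit.mk _ (fun c => Y.fixedDesc hd c.π (hk c.π c.condition)) ?_ ?_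
    · exact fun c => hom_ext (hk c.π c.condition)
    · intro c m hm
      refine hom_ext fun x => ?_
      have h := congr_toFun hm x.1
      refine Eq.trans (congrArg m.toTFunctor.toFun (Subtype.ext x.2.symm)) h
  · refine (isColimitMapCoconeCoforkEquiv (forget 𝕋) hw).symm ?_
    let hs' : IsSplitCoequalizer ((forget 𝕋).map f) ((forget 𝕋).map g)
        ((forget 𝕋).map (Y.fixedProj hd)) :=
      -- The fixed points are in bijection with `Q`, so the given splitting transports along it.
      { rightSection := ↾(fun x => hs.rightSection (q x.1))
        leftSection := hs.leftSection
        condition := by rw [← Functor.map_comp, hw, Functor.map_comp]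
        rightSection_π := by
          ext x
          refine Subtype.ext (Eq.trans ?_ x.2)
          exact (hqd _ _).1 (hsq (q x.1))
        leftSection_bottom := hs.leftSection_bottom
        leftSection_top := by
          ext y
          refine (hft y).trans (congrArg hs.rightSection ?_)
          exact (hqd _ _).2 (hd.idem y).symm }
    exact hs'.isCoequalizer

/-- The forgetful functor is monadic. -/
theorem nonempty_monadicRightAdjoint (𝕋 : Theory V) :
    Nonempty (MonadicRightAdjoint (forget 𝕋)) :=
  have : Monad.HasCoequalizerOfIsSplitPair (forget 𝕋) := ⟨fun f g _ => by
    obtain ⟨c, ⟨hc⟩, -⟩ := exists_isColimit_of_isSplitPair f g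
    exact ⟨⟨c, hc⟩⟩⟩
  have : Monad.PreservesColimitOfIsSplitPair (forget 𝕋) := ⟨fun f g _ => by
    obtain ⟨c, ⟨hc⟩, ⟨hc'⟩⟩ := exists_isColimit_of_isSplitPair f g
    exact preservesColimit_of_preserves_colimit_cocone hc hc'⟩
  ⟨Monad.monadicOfHasPreservesGSplitCoequalizersOfReflectsIsomorphisms (adjunction 𝕋)⟩

/-! ### Colimits -/

/-- A morphism whose values lie in the image of a full subobject factors through it. -/
theorem exists_lift {A C X : CocomplSep 𝕋} {i : C ⟶ X} {r : TFunctor X.toTCat C.toTCat}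
    (hi : i.toTFunctor.Adj r) (hr : ∀ c, r.toFun (i.toTFunctor.toFun c) = c) (k : A ⟶ X)
    (hk : ∀ a, ∃ c, k.toTFunctor.toFun a = i.toTFunctor.toFun c) :
    ∃ k' : A ⟶ C, k'.toTFunctor = r.comp k.toTFunctor ∧ k' ≫ i = k := by
  obtain ⟨s, hs⟩ := exists_adj k
  have h : ∀ a, i.toTFunctor.toFun (r.toFun (k.toTFunctor.toFun a)) = k.toTFunctor.toFun a :=
    fun a => by
      obtain ⟨c, hc⟩ := hk a
      rw [hc, hr]
  refine ⟨⟨r.comp k.toTFunctor, TFunctor.Adj.isLeftAdjoint (r := s.comp i.toTFunctor) ?_⟩, rfl,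
    hom_ext h⟩
  -- The right adjoint of `r k` is `s i`: `C(T(r k) w, c) = X(T(i r k) w, i c) = X(T k w, i c) =
  -- A(w, s i c)`.
  intro w c
  refine Eq.trans ?_ (hs w (i.toTFunctor.toFun c))
  have h1 := hi (mapT 𝕋.T (r.comp k.toTFunctor).toFun w) (i.toTFunctor.toFun c)
  rw [hr, ← mapT_comp] at h1
  refine h1.symm.trans (congrArg (X.toTCat.str · _) ?_)
  exact congrArg (mapT 𝕋.T · w) (funext h)

/-- A cocone with vertex `X` induces `l : F ⟶ X` from the free object on the disjoint union of the
diagram. With `r` right adjoint to `l`, the fixed points of `r l` embed in `X` with image that of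
`l`, which contains all values of the cocone. -/
theorem solutionSetCondition_const (J : Type u) [SmallCategory J] :
    SolutionSetCondition.{u} (Functor.const J : CocomplSep 𝕋 ⥤ J ⥤ CocomplSep 𝕋) := by
  intro D
  let F := free 𝕋 (Σ j, (D.obj j).toTCat)
  refine ⟨Σ d : {d : TFunctor F.toTCat F.toTCat // d.IsClosure},
    D ⟶ (Functor.const J).obj (F.fixed d.2), fun i => F.fixed i.1.2, fun i => i.2, ?_⟩
  intro X h
  let u : (Σ j, (D.obj j).toTCat) → X.toTCat := fun p => (h.app p.1).toTFunctor.toFun p.2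
  let l : F ⟶ X := freeDesc u
  obtain ⟨r, hr⟩ := exists_adj l
  have hd : (r.comp l.toTFunctor).IsClosure :=
    ⟨hr.unit, fun x => congrArg r.toFun (hr.left_right_left X.isLSeparated x)⟩
  have hl := hr.left_right_left X.isLSeparated
  let i : F.fixed hd ⟶ X := F.fixedDesc hd l hl
  obtain ⟨r', hr', hrr⟩ := hd.desc_adj F.isLSeparated hr hl
  have hri : ∀ c, r'.toFun (i.toTFunctor.toFun c) = c := fun c =>
    Subtype.ext ((hrr _).trans c.2)
  have hk : ∀ j a, ∃ c, (h.app j).toTFunctor.toFun a = i.toTFunctor.toFun c := fun j a =>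
    ⟨(F.fixedProj hd).toTFunctor.toFun ((TFunctor.yoneda 𝕋 _).toFun ⟨j, a⟩),
      ((hl _).trans (freeDesc_yoneda u ⟨j, a⟩)).symm⟩
  choose k hk1 hk2 using fun j => exists_lift (i := i) hr' hri (h.app j) (hk j)
  -- Each leg is `r'` after the original leg, so naturality is inherited from `h`.
  refine ⟨⟨⟨_, hd⟩, { app := k, naturality := fun j j' φ => ?_ }⟩, i, ?_⟩
  · refine hom_ext fun a => ?_
    change (k j').toTFunctor.toFun _ = (k j).toTFunctor.toFun a
    rw [hk1, hk1]
    exact congrArg r'.toFun (congr_toFun (h.naturality φ) a)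
  · ext j : 2
    exact hk2 j

/-- Limits are created by the monadic functor to sets; they let the adjoint functor theorem supply
left adjoints to the diagonal functors. -/
theorem hasColimits (𝕋 : Theory V) : HasColimits (CocomplSep 𝕋) := by
  obtain ⟨_⟩ := nonempty_monadicRightAdjoint 𝕋
  have := monadicCreatesLimits.{u, u} (forget 𝕋)
  have : HasLimits (CocomplSep 𝕋) := hasLimits_of_hasLimits_createsLimits (forget 𝕋)
  refine ⟨fun J _ => ?_⟩
  rw [hasColimitsOfShape_iff_isRightAdjoint_const]
  exact isRightAdjoint_of_preservesLimits_of_solutionSetCondition _ (solutionSetCondition_const J)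

end CocomplSep

end TopTheory

theorem mainTheorem7 {V : Type u} [CommMonoid V] [CompleteLattice V] [IsQuantale V]
    (hV : (⊥ : V) < 1) (𝕋 : TopTheory.Theory V) :
    Nonempty (MonadicRightAdjoint (TopTheory.CocomplSep.forget 𝕋)) ∧
      HasColimits (TopTheory.CocomplSep 𝕋) :=
  ⟨TopTheory.CocomplSep.nonempty_monadicRightAdjoint 𝕋, TopTheory.CocomplSep.hasColimits 𝕋⟩
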